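/- Let $\mathcal A$ be an abelian category. A subcategory of $\mathcal A$ means a full additive subcategory closed under isomorphisms. Let $\mathcal W\subseteq\mathcal X$ be subcategories of $\mathcal A$. Write $\mathcal X\perp\mathcal Y$ if $\operatorname{Ext}^i_{\mathcal A}(X,Y)=0$ for all $i\ge 1$, $X\in\mathcal X$, $Y\in\mathcal Y$. The subcategory $\mathcal W$ is an \emph{injective cogenerator} for $\mathcal X$ if $\mathcal X\perp\mathcal W$ and for each $X\in\mathcal X$ there is an exact sequence $0\to X\to W\to X'\to 0$ with $W\in\mathcal W$ and $X'\in\mathcal X$. It is a \emph{projective generator} for $\mathcal X$ if $\mathcal W\perp\mathcal X$ and for each $X\in\mathcal X$ there is an exact sequence $0\to X'\to W\to X\to 0$ with $W\in\mathcal W$ and $X'\in\mathcal X$. For a subcategory $\mathcal X$, a complex $K=(\cdots\to K_1\xrightarrow{\partial_1}K_0\xrightarrow{\partial_0}K_{-1}\to\cdots)$, indexed by $\mathbb Z$, of objects of $\mathcal X$ is \emph{totally $\mathcal X$-acyclic} if it is exact and the complexes $\operatorname{Hom}_{\mathcal A}(X,K)$ and $\operatorname{Hom}_{\mathcal A}(K,X)$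 are exact for every $X\in\mathcal X$. Let $\mathcal G(\mathcal X)$ be the subcategory of all objects $M$ with $M\cong\operatorname{Coker}(\partial_1)$ for some totally $\mathcal X$-acyclic complex $K$. Put $\mathcal G^0(\mathcal X)=\mathcal X$ and $\mathcal G^{n+1}(\mathcal X)=\mathcal G(\mathcal G^n(\mathcal X))$ for $n\ge 0$. \textbf{Theorem.} Suppose that $\mathcal X$ is closed under extensions (that is, for every exact sequence $0\to X'\to A\to X''\to 0$ in $\mathcal A$ with $X',X''\in\mathcal X$, also $A\in\mathcal X$) and that $\mathcal W$ is both an injective cogenerator and a projective generator for $\mathcal X$. Then $\mathcal G^n(\mathcal X)\subseteq\mathcal G(\mathcal W)$ for every $n\ge 1$. -/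

import Mathlib

open CategoryTheory Limits Opposite

universe w v u

namespace GorensteinSubcategory

variable {C : Type u} [Category.{v} C] [Abelian C]

/-- A property of objects of an abelian category, viewed as a full subcategory,
is a full additive subcategory that is closed under isomorphisms. -/
structure IsAdditiveSubcategory (P : ObjectProperty C) : Prop where
  closedUnderIso : P.IsClosedUnderIsomorphisms
  containsZero : P.ContainsZero
  biprod_mem : ∀ (A B : C), P A → P B → P (A ⊞ B)

/-- `X ⊥ Y`: `Ext^i(A, B) = 0` for all `i ≥ 1`, all `A` in `X` and all `B` in `Y`.
Here `Ext` is the Yoneda `Ext` of an abelian category. The class `HasExt.{w} C` only records a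
universe in which the `Ext`-groups live; `HasExt.standard` shows that it holds for every abelian
category when `w` is the larger of the two universes of `C`. -/
def Perp [HasExt.{w} C] (X Y : ObjectProperty C) : Prop :=
  ∀ (A B : C), X A → Y B → ∀ i : ℕ, 1 ≤ i → Subsingleton (Abelian.Ext.{w} A B i)

/-- `W` is a cogenerator for `X`: every `A` in `X` has a short exact sequence
`0 ⟶ A ⟶ I ⟶ A' ⟶ 0` in `X` with `I` in `W`. -/
def IsCogenerator (W X : ObjectProperty C) : Prop :=
  ∀ A : C, X A → ∃ (I A' : C) (f : A ⟶ I) (g : I ⟶ A') (h : f ≫ g = 0),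
    W I ∧ X I ∧ X A' ∧ (ShortComplex.mk f g h).ShortExact

/-- `W` is a generator for `X`: every `A` in `X` has a short exact sequence
`0 ⟶ A' ⟶ P ⟶ A ⟶ 0` in `X` with `P` in `W`. -/
def IsGenerator (W X : ObjectProperty C) : Prop :=
  ∀ A : C, X A → ∃ (A' P : C) (f : A' ⟶ P) (g : P ⟶ A) (h : f ≫ g = 0),
    X A' ∧ W P ∧ X P ∧ (ShortComplex.mk f g h).ShortExact

structure IsInjectiveCogenerator [HasExt.{w} C] (W X : ObjectProperty C) : Prop where
  isCogenerator : IsCogenerator W X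
  perp : Perp.{w} X W

structure IsProjectiveGenerator [HasExt.{w} C] (W X : ObjectProperty C) : Prop where
  isGenerator : IsGenerator W X
  perp : Perp.{w} W X

/-- The complex of abelian groups `Hom(A, K)`. -/
noncomputable abbrev homFrom (A : C) (K : ChainComplex C ℤ) :
    HomologicalComplex AddCommGrpCat.{v} (ComplexShape.down ℤ) :=
  ((preadditiveCoyoneda.obj (op A)).mapHomologicalComplex _).obj K

/-- The complex of abelian groups `Hom(K, A)`. -/
noncomputable abbrev homInto (K : ChainComplex C ℤ) (A : C) :
    HomologicalComplex AddCommGrpCat.{v} (ComplexShape.down ℤ).symm :=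
  ((preadditiveYoneda.obj A).mapHomologicalComplex _).obj K.op

/-- `K` is a totally `X`-acyclic complex: an unbounded exact complex of objects of `X` that is
both `Hom(X, -)`-exact and `Hom(-, X)`-exact. -/
structure IsTotallyAcyclic (X : ObjectProperty C) (K : ChainComplex C ℤ) : Prop where
  mem : ∀ i : ℤ, X (K.X i)
  acyclic : K.Acyclic
  homFrom_acyclic : ∀ A : C, X A → (homFrom A K).Acyclic
  homInto_acyclic : ∀ A : C, X A → (homInto K A).Acyclic

/-- The Gorenstein subcategory `G(X)`: the objects isomorphic to the cokernel of
`∂₁ : K₁ ⟶ K₀` for a totally `X`-acyclic complex `K`. -/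
def gorenstein (X : ObjectProperty C) : ObjectProperty C := fun M =>
  ∃ K : ChainComplex C ℤ, IsTotallyAcyclic X K ∧ Nonempty (M ≅ cokernel (K.d 1 0))

/-- The iterates `G^0(X) = X` and `G^(n+1)(X) = G(G^n(X))`. -/
def gorensteinIter (X : ObjectProperty C) : ℕ → ObjectProperty C
  | 0 => X
  | n + 1 => gorenstein (gorensteinIter X n)

end GorensteinSubcategory

namespace GorensteinSubcategory

variable {C : Type u} [Category.{v} C] [Abelian C]

/-! The engine is `gorenstein_le_gorenstein`: if `W ⊆ Y ⊆ X`, where `X` is extension closed and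
`Ext¹`-orthogonal to `W` on both sides, and `W` generates and cogenerates `X`, then `G(Y) ⊆ G(W)`. A
totally `Y`-acyclic complex is `Hom`-exact against `W`, so its syzygies are `Ext¹`-orthogonal to
`W`. Its terms lie in `X`; embedding them in objects of `W` and absorbing the cokernels into the
next terms by pushouts (extension closure) turns the right half into a `W`-coresolution with
orthogonal cosyzygies. The left half is dual, and the halves splice.

Induct on `n`. For `n = 1` take `Y = X`. Afterwards the ambient class is `G(W)`: it is orthogonal to
`W`, has `W` as generator and cogenerator, and is extension closed by a horseshoe argument. Apply
the engine to `Y = G^n(X)`, which contains `W` by contractible complexes and lies in `G(W)` by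
induction. -/

/-! ### Pushouts, pullbacks and sums of short exact sequences -/

/-- There is a short exact sequence `0 ⟶ A ⟶ B ⟶ D ⟶ 0`. -/
def Conflation (A B D : C) : Prop :=
  ∃ (f : A ⟶ B) (g : B ⟶ D) (h : f ≫ g = 0), (ShortComplex.mk f g h).ShortExact

lemma Conflation.op {A B D : C} (h : Conflation A B D) :
    Conflation (Opposite.op D) (Opposite.op B) (Opposite.op A) := by
  obtain ⟨f, g, w, hs⟩ := h
  exact ⟨g.op, f.op, by rw [← op_comp, w, op_zero], hs.op⟩

lemma Conflation.unop {A B D : Cᵒᵖ} (h : Conflation A B D) :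
    Conflation D.unop B.unop A.unop := by
  obtain ⟨f, g, w, hs⟩ := h
  exact ⟨g.unop, f.unop, by rw [← unop_comp, w, unop_zero], hs.unop⟩

lemma Conflation.of_iso {A B D A' B' D' : C} (h : Conflation A B D)
    (a : A ≅ A') (b : B ≅ B') (d : D ≅ D') : Conflation A' B' D' := by
  obtain ⟨f, g, w, hs⟩ := h
  refine ⟨a.inv ≫ f ≫ b.hom, b.inv ≫ g ≫ d.hom, by simp [reassoc_of% w], ?_⟩
  exact ShortComplex.shortExact_of_iso (ShortComplex.isoMk a b d (by simp) (by simp)) hs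

/-- The pushout of a short exact sequence along a morphism is a short exact sequence. -/
lemma shortExact_of_isPushout {A B D A' P : C} {f : A ⟶ B} {g : B ⟶ D} {w : f ≫ g = 0}
    (hs : (ShortComplex.mk f g w).ShortExact) {φ : A ⟶ A'} {inl : B ⟶ P} {inr : A' ⟶ P}
    (sq : IsPushout f φ inl inr) : Conflation A' P D := by
  have := hs.mono_f
  have := hs.epi_g
  dsimp at *
  have hinr : Mono inr :=
    (MorphismProperty.monomorphisms C).of_isPushout sq.flip (inferInstanceAs (Mono f))
  have hg : inl ≫ sq.desc g 0 (by simp [w]) = g := sq.inl_desc _ _ _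
  have hepi : Epi (sq.desc g 0 (by simp [w])) := by
    have : Epi (inl ≫ sq.desc g 0 (by simp [w])) := by rw [hg]; infer_instance
    exact epi_of_epi inl _
  refine ⟨inr, sq.desc g 0 (by simp [w]), by simp, ?_⟩
  refine { exact := ?_, mono_f := hinr, epi_g := hepi }
  refine ShortComplex.exact_of_g_is_cokernel _
    (CokernelCofork.IsColimit.ofπ' _ _ fun {Z} k hk => ⟨hs.exact.desc (inl ≫ k) ?_, ?_⟩)
  · dsimp at hk ⊢
    rw [sq.w_assoc, hk, comp_zero]
  · dsimp at hk ⊢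
    refine sq.hom_ext ?_ (by simp [hk])
    rw [sq.inl_desc_assoc]
    exact hs.exact.g_desc _ _

/-- Pushout of two monomorphisms with the same source. -/
lemma Conflation.exists_pushout {A B D B' D' : C} (h : Conflation A B D)
    (h' : Conflation A B' D') : ∃ P, Conflation B' P D ∧ Conflation B P D' := by
  obtain ⟨f, g, w, hs⟩ := h
  obtain ⟨f', g', w', hs'⟩ := h'
  exact ⟨pushout f f', shortExact_of_isPushout hs (IsPushout.of_hasPushout f f'),
    shortExact_of_isPushout hs' (IsPushout.of_hasPushout f f').flip⟩

/-- If `U ⊆ V ⊆ I`, then `I ⧸ U` is an extension of `I ⧸ V` by `V ⧸ U`. -/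
lemma Conflation.exists_quotient {U V Z I V' : C} (h : Conflation U V Z)
    (h' : Conflation V I V') : ∃ Q, Conflation Z Q V' ∧ Conflation U I Q := by
  obtain ⟨k, φ, w, hs⟩ := h
  obtain ⟨f, g, w', hs'⟩ := h'
  have := hs.mono_f
  have := hs.epi_g
  have := hs'.mono_f
  dsimp at *
  have sq := IsPushout.of_hasPushout f φ
  refine ⟨pushout f φ, shortExact_of_isPushout hs' sq,
    k ≫ f, pushout.inl f φ, by rw [Category.assoc, sq.w, reassoc_of% w, zero_comp], ?_⟩
  refine { exact := ?_, mono_f := mono_comp k f, epi_g := by dsimp; infer_instance }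
  refine ShortComplex.exact_of_g_is_cokernel _
    (CokernelCofork.IsColimit.ofπ' _ _ fun {Z} z hz =>
      ⟨sq.desc z (hs.exact.desc (f ≫ z) (by simpa using hz)) ?_, sq.inl_desc _ _ _⟩)
  exact (hs.exact.g_desc _ _).symm

/-- Pullback of two epimorphisms with the same target. -/
lemma Conflation.exists_pullback {A B D B' A' : C} (h : Conflation A B D)
    (h' : Conflation A' B' D) : ∃ P, Conflation A P B' ∧ Conflation A' P B := by
  obtain ⟨P, h₁, h₂⟩ := h.op.exists_pushout h'.op
  exact ⟨P.unop, h₁.unop, h₂.unop⟩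

/-- The kernel of a composite of epimorphisms is an extension of their kernels. -/
lemma Conflation.exists_kernel {U V Z I V' : C} (h : Conflation Z V U)
    (h' : Conflation V' I V) : ∃ Q, Conflation V' Q Z ∧ Conflation Q I U := by
  obtain ⟨Q, h₁, h₂⟩ := h.op.exists_quotient h'.op
  exact ⟨Q.unop, h₁.unop, h₂.unop⟩

lemma Conflation.biprod_left {A B D : C} (h : Conflation A B D) (E : C) :
    Conflation (E ⊞ A) (E ⊞ B) D := by
  obtain ⟨f, g, w, hs⟩ := h
  have := hs.mono_f
  have := hs.epi_g
  dsimp at *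
  refine ⟨biprod.map (𝟙 E) f, biprod.snd ≫ g, by simp [w], ?_⟩
  refine { exact := ?_, mono_f := by dsimp; infer_instance, epi_g := epi_comp _ _ }
  refine ShortComplex.exact_of_g_is_cokernel _
    (CokernelCofork.IsColimit.ofπ' _ _ fun {Z} z hz =>
      ⟨hs.exact.desc (biprod.inr ≫ z) ?_, ?_⟩)
  · simpa using biprod.inr ≫= hz
  · have h₁ : biprod.inl ≫ z = 0 := by simpa using biprod.inl ≫= hz
    have h₂ := hs.exact.g_desc (biprod.inr ≫ z) (by simpa using biprod.inr ≫= hz)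
    dsimp at h₂ ⊢
    apply biprod.hom_ext' <;> simp [h₁, h₂]

lemma Conflation.biprod_right {A B D : C} (h : Conflation A B D) (E : C) :
    Conflation A (E ⊞ B) (E ⊞ D) := by
  obtain ⟨f, g, w, hs⟩ := h
  have := hs.mono_f
  have := hs.epi_g
  dsimp at *
  refine ⟨f ≫ biprod.inr, biprod.map (𝟙 E) g, by simp [reassoc_of% w], ?_⟩
  refine { exact := ?_, mono_f := mono_comp _ _, epi_g := by dsimp; infer_instance }
  refine ShortComplex.exact_of_f_is_kernel _
    (KernelFork.IsLimit.ofι' _ _ fun {Z} z hz =>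
      ⟨hs.exact.lift (z ≫ biprod.snd) ?_, ?_⟩)
  · simpa using hz =≫ biprod.snd
  · have h₁ : z ≫ biprod.fst = 0 := by simpa using hz =≫ biprod.fst
    have h₂ := hs.exact.lift_f (z ≫ biprod.snd) (by simpa using hz =≫ biprod.snd)
    dsimp at h₂ ⊢
    apply biprod.hom_ext <;> simp [h₁, reassoc_of% h₂]

/-! ### `Ext¹`-orthogonality and lifting properties -/

section ExtOrthogonal

variable [HasExt.{w} C]

/-- The objects `U` with `Ext¹(A, U) = 0 = Ext¹(U, A)` for all `A` in `W`. -/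
def extOrthogonal (W : ObjectProperty C) : ObjectProperty C := fun U =>
  ∀ A : C, W A → Subsingleton (Abelian.Ext.{w} A U 1) ∧ Subsingleton (Abelian.Ext.{w} U A 1)

lemma extOrthogonal_of_iso {W : ObjectProperty C} {U V : C} (e : U ≅ V)
    (hU : extOrthogonal.{w} W U) : extOrthogonal.{w} W V := by
  intro A hA
  obtain ⟨h₁, h₂⟩ := hU A hA
  constructor
  · refine subsingleton_of_forall_eq 0 fun x => ?_
    have : x = (x.comp (Abelian.Ext.mk₀ e.inv) (add_zero 1)).comp
        (Abelian.Ext.mk₀ e.hom) (add_zero 1) := by simp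
    rw [this, Subsingleton.elim (x.comp (Abelian.Ext.mk₀ e.inv) (add_zero 1)) 0,
      Abelian.Ext.zero_comp]
  · refine subsingleton_of_forall_eq 0 fun x => ?_
    have : x = (Abelian.Ext.mk₀ e.inv).comp
        ((Abelian.Ext.mk₀ e.hom).comp x (zero_add 1)) (zero_add 1) := by simp
    rw [this, Subsingleton.elim ((Abelian.Ext.mk₀ e.hom).comp x (zero_add 1)) 0,
      Abelian.Ext.comp_zero]

lemma Conflation.mem_extOrthogonal {W : ObjectProperty C} {A B D : C} (h : Conflation A B D)
    (hA : extOrthogonal.{w} W A) (hD : extOrthogonal.{w} W D) : extOrthogonal.{w} W B := by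
  obtain ⟨f, g, w, hs⟩ := h
  intro I hI
  obtain ⟨h₁, h₂⟩ := hA I hI
  obtain ⟨h₃, h₄⟩ := hD I hI
  constructor
  · refine subsingleton_of_forall_eq 0 fun x => ?_
    obtain ⟨y, rfl⟩ := Abelian.Ext.covariant_sequence_exact₂ _ hs x
      (Subsingleton.elim (α := Abelian.Ext.{w} I D 1) _ _)
    rw [Subsingleton.elim (α := Abelian.Ext.{w} I A 1) y 0, Abelian.Ext.zero_comp]
  · refine subsingleton_of_forall_eq 0 fun x => ?_
    obtain ⟨y, rfl⟩ := Abelian.Ext.contravariant_sequence_exact₂ hs _ x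
      (Subsingleton.elim (α := Abelian.Ext.{w} A I 1) _ _)
    rw [Subsingleton.elim (α := Abelian.Ext.{w} D I 1) y 0, Abelian.Ext.comp_zero]

lemma exists_lift_of_subsingleton_ext {S : ShortComplex C} (hS : S.ShortExact) {A : C}
    (h : Subsingleton (Abelian.Ext.{w} A S.X₁ 1)) (x : A ⟶ S.X₃) :
    ∃ y : A ⟶ S.X₂, y ≫ S.g = x := by
  obtain ⟨y, hy⟩ := Abelian.Ext.covariant_sequence_exact₃ A hS (Abelian.Ext.mk₀ x)
    (zero_add 1) (Subsingleton.elim _ _)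
  obtain ⟨y, rfl⟩ := (Abelian.Ext.mk₀_bijective _ _).2 y
  rw [Abelian.Ext.mk₀_comp_mk₀] at hy
  exact ⟨y, (Abelian.Ext.mk₀_bijective _ _).1 hy⟩

lemma exists_extension_of_subsingleton_ext {S : ShortComplex C} (hS : S.ShortExact) {A : C}
    (h : Subsingleton (Abelian.Ext.{w} S.X₃ A 1)) (x : S.X₁ ⟶ A) :
    ∃ y : S.X₂ ⟶ A, S.f ≫ y = x := by
  obtain ⟨y, hy⟩ := Abelian.Ext.contravariant_sequence_exact₁ hS A (Abelian.Ext.mk₀ x)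
    (add_zero 1) (Subsingleton.elim _ _)
  obtain ⟨y, rfl⟩ := (Abelian.Ext.mk₀_bijective _ _).2 y
  rw [Abelian.Ext.mk₀_comp_mk₀] at hy
  exact ⟨y, (Abelian.Ext.mk₀_bijective _ _).1 hy⟩

/-- The connecting map `Hom(A, X₃) → Ext¹(A, X₁)` is onto because `Ext¹(A, X₂) = 0`, and zero
because every morphism lifts. -/
lemma subsingleton_ext_of_exists_lift {S : ShortComplex C} (hS : S.ShortExact) {A : C}
    (h : Subsingleton (Abelian.Ext.{w} A S.X₂ 1))
    (hl : ∀ x : A ⟶ S.X₃, ∃ y : A ⟶ S.X₂, y ≫ S.g = x) :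
    Subsingleton (Abelian.Ext.{w} A S.X₁ 1) := by
  refine subsingleton_of_forall_eq 0 fun z => ?_
  obtain ⟨x, rfl⟩ := Abelian.Ext.covariant_sequence_exact₁ A hS z (Subsingleton.elim _ _)
    (zero_add 1)
  obtain ⟨x, rfl⟩ := (Abelian.Ext.mk₀_bijective _ _).2 x
  obtain ⟨y, rfl⟩ := hl x
  rw [← Abelian.Ext.mk₀_comp_mk₀, Abelian.Ext.comp_assoc_of_second_deg_zero, hS.comp_extClass,
    Abelian.Ext.comp_zero]

lemma subsingleton_ext_of_exists_extension {S : ShortComplex C} (hS : S.ShortExact) {A : C}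
    (h : Subsingleton (Abelian.Ext.{w} S.X₂ A 1))
    (hl : ∀ x : S.X₁ ⟶ A, ∃ y : S.X₂ ⟶ A, S.f ≫ y = x) :
    Subsingleton (Abelian.Ext.{w} S.X₃ A 1) := by
  refine subsingleton_of_forall_eq 0 fun z => ?_
  obtain ⟨x, rfl⟩ := Abelian.Ext.contravariant_sequence_exact₃ hS A z (Subsingleton.elim _ _)
    (add_zero 1)
  obtain ⟨x, rfl⟩ := (Abelian.Ext.mk₀_bijective _ _).2 x
  obtain ⟨y, rfl⟩ := hl x
  rw [← Abelian.Ext.mk₀_comp_mk₀, hS.extClass_comp_assoc]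

lemma Conflation.nonempty_iso_biprod {A B D : C} (h : Conflation A B D)
    (hDA : Subsingleton (Abelian.Ext.{w} D A 1)) : Nonempty (B ≅ A ⊞ D) := by
  obtain ⟨f, g, w, hs⟩ := h
  obtain ⟨s, hs'⟩ := exists_lift_of_subsingleton_ext hs hDA (𝟙 D)
  exact ⟨(ShortComplex.Splitting.ofExactOfSection _ hs.exact s hs'
    hs.mono_f).isoBinaryBiproduct⟩

end ExtOrthogonal

/-! ### Exactness of complexes and their syzygies -/

lemma homFrom_acyclic_iff (A : C) (K : ChainComplex C ℤ) :
    (homFrom A K).Acyclic ↔ ∀ (i : ℤ) (x : A ⟶ K.X (i + 1)), x ≫ K.d (i + 1) i = 0 →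
      ∃ y : A ⟶ K.X (i + 1 + 1), y ≫ K.d (i + 1 + 1) (i + 1) = x := by
  have key (i : ℤ) : (homFrom A K).ExactAt (i + 1) ↔
      ∀ (x : A ⟶ K.X (i + 1)), x ≫ K.d (i + 1) i = 0 →
      ∃ y : A ⟶ K.X (i + 1 + 1), y ≫ K.d (i + 1 + 1) (i + 1) = x := by
    rw [HomologicalComplex.exactAt_iff' _ (i + 1 + 1) (i + 1) i (by simp) (by simp),
      ShortComplex.ab_exact_iff]
    rfl
  exact ⟨fun h i => (key i).1 (h _), fun h i => by
    obtain ⟨j, rfl⟩ : ∃ j, i = j + 1 := ⟨i - 1, by simp⟩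
    exact (key j).2 (h j)⟩

lemma homInto_acyclic_iff (K : ChainComplex C ℤ) (A : C) :
    (homInto K A).Acyclic ↔ ∀ (i : ℤ) (x : K.X (i + 1) ⟶ A),
      K.d (i + 1 + 1) (i + 1) ≫ x = 0 → ∃ y : K.X i ⟶ A, K.d (i + 1) i ≫ y = x := by
  have key (i : ℤ) : (homInto K A).ExactAt (i + 1) ↔
      ∀ (x : K.X (i + 1) ⟶ A), K.d (i + 1 + 1) (i + 1) ≫ x = 0 →
      ∃ y : K.X i ⟶ A, K.d (i + 1) i ≫ y = x := by
    rw [HomologicalComplex.exactAt_iff' _ i (i + 1) (i + 1 + 1)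
      (ComplexShape.prev_eq' _ rfl) (ComplexShape.next_eq' _ rfl),
      ShortComplex.ab_exact_iff]
    rfl
  exact ⟨fun h i => (key i).1 (h _), fun h i => by
    obtain ⟨j, rfl⟩ : ∃ j, i = j + 1 := ⟨i - 1, by simp⟩
    exact (key j).2 (h j)⟩

lemma acyclic_iff_exact (K : ChainComplex C ℤ) :
    K.Acyclic ↔ ∀ i : ℤ, (K.sc' (i + 1 + 1) (i + 1) i).Exact := by
  have key (i : ℤ) : K.ExactAt (i + 1) ↔ (K.sc' (i + 1 + 1) (i + 1) i).Exact :=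
    HomologicalComplex.exactAt_iff' _ (i + 1 + 1) (i + 1) i (by simp) (by simp)
  exact ⟨fun h i => (key i).1 (h _), fun h i => by
    obtain ⟨j, rfl⟩ : ∃ j, i = j + 1 := ⟨i - 1, by simp⟩
    exact (key j).2 (h j)⟩

/-- Every object of `Z` is both a cosyzygy and a syzygy, with middle term in `Y`, of an
object of `Z`. -/
structure IsSyzygyClosed (Y Z : ObjectProperty C) : Prop where
  exists_cosyzygy : ∀ U, Z U → ∃ I U', Y I ∧ Z U' ∧ Conflation U I U'
  exists_syzygy : ∀ U, Z U → ∃ U' P, Z U' ∧ Y P ∧ Conflation U' P U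

lemma shortExact_cokernel {K : ChainComplex C ℤ} (hK : K.Acyclic) (i : ℤ) :
    (ShortComplex.mk (cokernel.desc (K.d (i + 1 + 1) (i + 1)) (K.d (i + 1) i)
      (K.d_comp_d _ _ _)) (cokernel.π (K.d (i + 1) i)) (by
        rw [← cancel_epi (cokernel.π _)]; simp)).ShortExact := by
  have h := (acyclic_iff_exact K).1 hK i
  have hm : Mono (cokernel.desc (K.d (i + 1 + 1) (i + 1)) (K.d (i + 1) i)
      (K.d_comp_d _ _ _)) := h.mono_cokernelDesc
  refine { exact := ?_, mono_f := hm, epi_g := by dsimp; infer_instance }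
  refine ShortComplex.exact_of_g_is_cokernel _
    (CokernelCofork.IsColimit.ofπ' _ _ fun {Z} k hk => ⟨cokernel.desc _ k ?_, cokernel.π_desc _ _ _⟩)
  simpa using cokernel.π (K.d (i + 1 + 1) (i + 1)) ≫= hk

/-- `Hom`-exactness of `K` provides the lifts and extensions along the syzygy sequences, whose
middle terms are orthogonal to `W`. -/
lemma cokernel_mem_extOrthogonal [HasExt.{w} C] {W : ObjectProperty C} {K : ChainComplex C ℤ}
    (hK : K.Acyclic) (hmem : ∀ i, extOrthogonal.{w} W (K.X i))
    (hfrom : ∀ A, W A → (homFrom A K).Acyclic) (hinto : ∀ A, W A → (homInto K A).Acyclic)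
    (i : ℤ) : extOrthogonal.{w} W (cokernel (K.d (i + 1) i)) := by
  intro A hA
  constructor
  · obtain ⟨j, rfl⟩ : ∃ j, i = j + 1 := ⟨i - 1, by simp⟩
    obtain ⟨k, rfl⟩ : ∃ k, j = k + 1 := ⟨j - 1, by simp⟩
    refine subsingleton_ext_of_exists_lift (shortExact_cokernel hK (k + 1))
      (hmem _ A hA).1 fun x => ?_
    have hm := (shortExact_cokernel hK k).mono_f
    dsimp only at x hm
    let m := cokernel.desc (K.d (k + 1 + 1) (k + 1)) (K.d (k + 1) k) (K.d_comp_d _ _ _)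
    obtain ⟨k, rfl⟩ : ∃ l, k = l + 1 := ⟨k - 1, by simp⟩
    have hm0 : m ≫ K.d (k + 1) k = 0 := by
      rw [← cancel_epi (cokernel.π _)]; simp [m]
    -- Through the monomorphism `m`, `x` becomes a cycle of `Hom(A, K)`, hence a boundary;
    -- cancelling `m` makes `y` a lift of `x`.
    obtain ⟨y, hy⟩ := (homFrom_acyclic_iff A K).1 (hfrom A hA) k (x ≫ m)
      (by rw [Category.assoc, hm0, comp_zero])
    refine ⟨y, ?_⟩
    rw [← cancel_mono m, Category.assoc, ← hy]
    simp [m]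
  · refine subsingleton_ext_of_exists_extension (shortExact_cokernel hK i)
      (hmem _ A hA).2 fun x => ?_
    dsimp at x
    obtain ⟨y, hy⟩ := (homInto_acyclic_iff K A).1 (hinto A hA) i (cokernel.π _ ≫ x) (by simp)
    refine ⟨y, ?_⟩
    rw [← cancel_epi (cokernel.π _)]
    simpa using hy

/-- Cokernels of the differentials of a suitable acyclic complex form a syzygy-closed class. -/
lemma exists_isSyzygyClosed [HasExt.{w} C] {Y W : ObjectProperty C} {K : ChainComplex C ℤ}
    (hK : K.Acyclic) (hmem : ∀ i, Y (K.X i)) (hY : Y ≤ extOrthogonal.{w} W)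
    (hfrom : ∀ A, W A → (homFrom A K).Acyclic) (hinto : ∀ A, W A → (homInto K A).Acyclic)
    {M : C} {i j : ℤ} (hj : i + 1 = j)
    (e : M ≅ cokernel (K.d j i)) :
    ∃ Z : ObjectProperty C, Z M ∧ Z ≤ extOrthogonal.{w} W ∧ IsSyzygyClosed Y Z := by
  subst hj
  have conf (i : ℤ) : Conflation (cokernel (K.d (i + 1 + 1) (i + 1))) (K.X i)
      (cokernel (K.d (i + 1) i)) := ⟨_, _, _, shortExact_cokernel hK i⟩
  refine ⟨fun U => ∃ i : ℤ, Nonempty (U ≅ cokernel (K.d (i + 1) i)), ⟨i, ⟨e⟩⟩, ?_, ?_, ?_⟩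
  · rintro U ⟨i, ⟨e⟩⟩
    exact extOrthogonal_of_iso e.symm
      (cokernel_mem_extOrthogonal hK (fun i => hY _ (hmem i)) hfrom hinto i)
  · rintro U ⟨i, ⟨e⟩⟩
    obtain ⟨j, rfl⟩ : ∃ j, i = j + 1 := ⟨i - 1, by simp⟩
    exact ⟨_, _, hmem j, ⟨j, ⟨Iso.refl _⟩⟩, (conf j).of_iso e.symm (Iso.refl _) (Iso.refl _)⟩
  · rintro U ⟨i, ⟨e⟩⟩
    exact ⟨_, _, ⟨i + 1, ⟨Iso.refl _⟩⟩, hmem i, (conf i).of_iso (Iso.refl _) (Iso.refl _) e.symm⟩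

/-! ### Splicing resolutions into totally acyclic complexes -/

lemma exists_sequence_of_forall_exists {α : Type*} (p : α → Prop) (r : α → α → Prop)
    (h : ∀ a, p a → ∃ b, p b ∧ r a b) {a : α} (ha : p a) :
    ∃ s : ℕ → α, s 0 = a ∧ ∀ n, p (s n) ∧ r (s n) (s (n + 1)) := by
  choose! f hf using h
  have hp (n : ℕ) : p (f^[n] a) := by
    induction n with
    | zero => exact ha
    | succ n ih => rw [Function.iterate_succ_apply']; exact (hf _ ih).1
  refine ⟨fun n => f^[n] a, rfl, fun n => ⟨hp n, ?_⟩⟩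
  dsimp only
  rw [Function.iterate_succ_apply']
  exact (hf _ (hp n)).2

/-- Splicing short exact sequences `0 ⟶ Z (i + 1) ⟶ P i ⟶ Z i ⟶ 0` which remain exact under
`Hom(A, -)` and `Hom(-, A)` for `A` in `W`. -/
lemma gorenstein_of_shortExact {W : ObjectProperty C} {Z P : ℤ → C} (hP : ∀ i, W (P i))
    {f : ∀ i, Z (i + 1) ⟶ P i} {g : ∀ i, P i ⟶ Z i} (w : ∀ i, f i ≫ g i = 0)
    (hs : ∀ i, (ShortComplex.mk (f i) (g i) (w i)).ShortExact)
    (hl : ∀ A, W A → ∀ i (x : A ⟶ Z i), ∃ y, y ≫ g i = x)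
    (he : ∀ A, W A → ∀ i (x : Z (i + 1) ⟶ A), ∃ y, f i ≫ y = x) : gorenstein W (Z 0) := by
  have hf (i : ℤ) : Mono (f i) := (hs i).mono_f
  have hg (i : ℤ) : Epi (g i) := (hs i).epi_g
  let K : ChainComplex C ℤ := ChainComplex.of P (fun i => g (i + 1) ≫ f i)
    (fun i => by simp [reassoc_of% w])
  have hd (i : ℤ) : K.d (i + 1) i = g (i + 1) ≫ f i := by simp [K]
  have hker {A : C} (i : ℤ) (x : A ⟶ P (i + 1)) (hx : x ≫ K.d (i + 1) i = 0) :
      ∃ y, y ≫ f (i + 1) = x := by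
    rw [hd] at hx
    refine ⟨(hs (i + 1)).exact.lift x ?_, (hs (i + 1)).exact.lift_f _ _⟩
    rw [← cancel_mono (f i), zero_comp, Category.assoc, hx]
  have hcoker {A : C} (i : ℤ) (x : P (i + 1) ⟶ A) (hx : K.d (i + 1 + 1) (i + 1) ≫ x = 0) :
      ∃ y, g (i + 1) ≫ y = x := by
    rw [hd] at hx
    refine ⟨(hs (i + 1)).exact.desc x ?_, (hs (i + 1)).exact.g_desc _ _⟩
    rw [← cancel_epi (g (i + 1 + 1)), comp_zero, ← Category.assoc, hx]
  refine ⟨K, ⟨hP, ?_, ?_, ?_⟩, ⟨?_⟩⟩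
  · rw [acyclic_iff_exact]
    intro i
    rw [ShortComplex.exact_iff_exact_up_to_refinements]
    intro A x hx
    obtain ⟨z, rfl⟩ := hker i x hx
    obtain ⟨A', π, hπ, y, hy⟩ := surjective_up_to_refinements_of_epi (g (i + 1 + 1)) z
    refine ⟨A', π, hπ, y, ?_⟩
    change π ≫ z ≫ f (i + 1) = y ≫ K.d (i + 1 + 1) (i + 1)
    rw [hd, reassoc_of% hy]
  · intro A hA
    rw [homFrom_acyclic_iff]
    intro i x hx
    obtain ⟨z, rfl⟩ := hker i x hx
    obtain ⟨y, rfl⟩ := hl A hA _ z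
    exact ⟨y, by rw [hd, Category.assoc]⟩
  · intro A hA
    rw [homInto_acyclic_iff]
    intro i x hx
    obtain ⟨z, rfl⟩ := hcoker i x hx
    obtain ⟨y, rfl⟩ := he A hA _ z
    exact ⟨y, by rw [hd, Category.assoc]⟩
  · have hd0 : K.d 1 0 = g (0 + 1) ≫ f 0 := hd 0
    -- `Z 0` is the cokernel of `f 0`, and precomposing with the epimorphism `g 1` does not change
    -- the cokernel.
    exact ((hs 0).gIsCokernel.coconePointUniqueUpToIso (cokernelIsCokernel (f 0))) ≪≫
      (cokernelEpiComp (g (0 + 1)) (f 0)).symm ≪≫ cokernelIsoOfEq hd0.symm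

lemma gorenstein_of_sequence [HasExt.{w} C] {W : ObjectProperty C} {Z : ℤ → C}
    (hZ : ∀ i, extOrthogonal.{w} W (Z i))
    (h : ∀ i, ∃ P, W P ∧ Conflation (Z (i + 1)) P (Z i)) : gorenstein W (Z 0) := by
  choose P hP f g w hs using h
  exact gorenstein_of_shortExact hP w hs
    (fun A hA i => exists_lift_of_subsingleton_ext (hs i) (hZ _ A hA).1)
    (fun A hA i => exists_extension_of_subsingleton_ext (hs i) (hZ _ A hA).2)

/-- An object with a `W`-coresolution and a `W`-resolution, all of whose syzygies are
`Ext¹`-orthogonal to `W`, lies in the Gorenstein subcategory. -/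
lemma mem_gorenstein [HasExt.{w} C] {W E F : ObjectProperty C}
    (hE : E ≤ extOrthogonal.{w} W) (hF : F ≤ extOrthogonal.{w} W)
    (hE' : ∀ U, E U → ∃ I U', W I ∧ E U' ∧ Conflation U I U')
    (hF' : ∀ U, F U → ∃ U' P, F U' ∧ W P ∧ Conflation U' P U)
    {M : C} (hME : E M) (hMF : F M) : gorenstein W M := by
  obtain ⟨s, rfl, hs⟩ := exists_sequence_of_forall_exists E
    (fun U U' => ∃ I, W I ∧ Conflation U I U')
    (fun U hU => by obtain ⟨I, U', h⟩ := hE' U hU; exact ⟨U', h.2.1, I, h.1, h.2.2⟩) hME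
  obtain ⟨t, ht₀, ht⟩ := exists_sequence_of_forall_exists F
    (fun U U' => ∃ P, W P ∧ Conflation U' P U)
    (fun U hU => by obtain ⟨U', P, h⟩ := hF' U hU; exact ⟨U', h.1, P, h.2.1, h.2.2⟩) hMF
  -- Syzygies sit in degrees `≥ 0`, cosyzygies in degrees `< 0`; `s 0 = t 0 = M`, so `negSucc n`,
  -- i.e. `-(n + 1)`, gets `s (n + 1)`.
  let Z : ℤ → C
    | .ofNat n => t n
    | .negSucc n => s (n + 1)
  rw [← ht₀]
  refine gorenstein_of_sequence (Z := Z) ?_ ?_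
  · rintro (n | n)
    · exact hF _ (ht n).1
    · exact hE _ (hs (n + 1)).1
  · rintro (n | _ | n)
    · exact (ht n).2
    · obtain ⟨I, hI⟩ := (hs 0).2
      rw [← ht₀] at hI
      exact ⟨I, hI⟩
    · exact (hs (n + 1)).2

/-! ### Replacing terms in `X` by terms in `W` -/

/-- An object which is syzygy-closed relative to `X` is Gorenstein for `W`, if `W` is a
generator and a cogenerator of the extension closed subcategory `X`, orthogonal to `W`. -/
lemma IsSyzygyClosed.le_gorenstein [HasExt.{w} C] {X W Z : ObjectProperty C}
    (hZ : IsSyzygyClosed X Z) (hZW : Z ≤ extOrthogonal.{w} W) (hXW : X ≤ extOrthogonal.{w} W)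
    (hX : ∀ {A B D : C}, Conflation A B D → X A → X D → X B)
    (hcogen : ∀ A, X A → ∃ I A', W I ∧ X A' ∧ Conflation A I A')
    (hgen : ∀ A, X A → ∃ A' P, X A' ∧ W P ∧ Conflation A' P A) : Z ≤ gorenstein W := by
  intro M hM
  refine mem_gorenstein
    -- Orthogonality is part of `E` and `F` because it need not pass to the kernel of `V ⟶ Z'` or
    -- the cokernel of `Z' ⟶ V`.
    (E := fun U => extOrthogonal.{w} W U ∧ ∃ V Z', X V ∧ Z Z' ∧ Conflation U V Z')
    (F := fun U => extOrthogonal.{w} W U ∧ ∃ Z' V, Z Z' ∧ X V ∧ Conflation Z' V U)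
    (fun _ h => h.1) (fun _ h => h.1) ?_ ?_
    ⟨hZW _ hM, hZ.exists_cosyzygy M hM⟩ ⟨hZW _ hM, hZ.exists_syzygy M hM⟩
  · rintro U ⟨-, V, Z', hV, hZ', h⟩
    obtain ⟨I, V', hI, hV', h'⟩ := hcogen V hV
    -- `U' = I ⧸ U` is an extension of `V'` by `Z'`. Pushing out along `Z' ⟶ Y` embeds it, with
    -- cokernel `Z₂`, in `P`, an extension of `V'` by `Y` and so in `X`.
    obtain ⟨U', h₁, h₂⟩ := h.exists_quotient h'
    obtain ⟨Y, Z₂, hY, hZ₂, h₃⟩ := hZ.exists_cosyzygy Z' hZ'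
    obtain ⟨P, h₄, h₅⟩ := h₁.exists_pushout h₃
    exact ⟨I, U', hI, ⟨h₁.mem_extOrthogonal (hZW _ hZ') (hXW _ hV'), P, Z₂, hX h₄ hY hV', hZ₂, h₅⟩, h₂⟩
  · rintro U ⟨-, Z', V, hZ', hV, h⟩
    obtain ⟨V', I, hV', hI, h'⟩ := hgen V hV
    obtain ⟨U', h₁, h₂⟩ := h.exists_kernel h'
    obtain ⟨Z₂, Y, hZ₂, hY, h₃⟩ := hZ.exists_syzygy Z' hZ'
    obtain ⟨P, h₄, h₅⟩ := h₁.exists_pullback h₃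
    exact ⟨U', I, ⟨h₁.mem_extOrthogonal (hXW _ hV') (hZW _ hZ'), Z₂, P, hZ₂, hX h₄ hV' hY, h₅⟩, hI, h₂⟩

/-! ### Stability properties of `G(W)` -/

section Gorenstein

variable [HasExt.{w} C] {W : ObjectProperty C}

lemma exists_isSyzygyClosed_of_gorenstein (hWW : W ≤ extOrthogonal.{w} W) {M : C}
    (hM : gorenstein W M) :
    ∃ Z : ObjectProperty C, Z M ∧ Z ≤ extOrthogonal.{w} W ∧ IsSyzygyClosed W Z := by
  obtain ⟨K, hK, ⟨e⟩⟩ := hM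
  exact exists_isSyzygyClosed hK.acyclic hK.mem hWW hK.homFrom_acyclic hK.homInto_acyclic
    (zero_add 1) e

lemma gorenstein_le_extOrthogonal (hWW : W ≤ extOrthogonal.{w} W) :
    gorenstein W ≤ extOrthogonal.{w} W := by
  intro M hM
  obtain ⟨Z, hZM, hZ, -⟩ := exists_isSyzygyClosed_of_gorenstein hWW hM
  exact hZ _ hZM

/-- All syzygies of a totally `W`-acyclic complex lie in `G(W)`, since `mem_gorenstein` applies to
each of them. -/
lemma isSyzygyClosed_gorenstein (hWW : W ≤ extOrthogonal.{w} W) :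
    IsSyzygyClosed W (gorenstein W) := by
  have key {Z : ObjectProperty C} (hZ : Z ≤ extOrthogonal.{w} W) (h : IsSyzygyClosed W Z) :
      Z ≤ gorenstein W := fun _ hM =>
    mem_gorenstein hZ hZ h.exists_cosyzygy h.exists_syzygy hM hM
  constructor
  · intro U hU
    obtain ⟨Z, hZU, hZ, h⟩ := exists_isSyzygyClosed_of_gorenstein hWW hU
    obtain ⟨I, U', hI, hU', h'⟩ := h.exists_cosyzygy U hZU
    exact ⟨I, U', hI, key hZ h _ hU', h'⟩
  · intro U hU
    obtain ⟨Z, hZU, hZ, h⟩ := exists_isSyzygyClosed_of_gorenstein hWW hU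
    obtain ⟨U', P, hU', hP, h'⟩ := h.exists_syzygy U hZU
    exact ⟨U', P, key hZ h _ hU', hP, h'⟩

/-- The Gorenstein subcategory of a self-orthogonal subcategory is closed under extensions. -/
lemma gorenstein_of_conflation (hWW : W ≤ extOrthogonal.{w} W)
    (hW : ∀ A B : C, W A → W B → W (A ⊞ B)) {A B D : C} (h : Conflation A B D)
    (hA : gorenstein W A) (hD : gorenstein W D) : gorenstein W B := by
  have hG := isSyzygyClosed_gorenstein hWW
  have hGW := gorenstein_le_extOrthogonal hWW
  let E : ObjectProperty C := fun U =>
    ∃ A D, gorenstein W A ∧ gorenstein W D ∧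
      Conflation A U D
  have hE : E ≤ extOrthogonal.{w} W := by
    rintro U ⟨A, D, hA, hD, h⟩
    exact h.mem_extOrthogonal (hGW _ hA) (hGW _ hD)
  refine mem_gorenstein hE hE ?_ ?_ (show E B from ⟨A, D, hA, hD, h⟩) ⟨A, D, hA, hD, h⟩
  · rintro U ⟨A, D, hA, hD, h⟩
    obtain ⟨I, A', hI, hA', h₁⟩ := hG.exists_cosyzygy A hA
    obtain ⟨J, D', hJ, hD', h₂⟩ := hG.exists_cosyzygy D hD
    -- Horseshoe: `P` is an extension of `D` by `I`, split since `Ext¹(D, I) = 0`. So `U` embeds in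
    -- `I ⊞ D`, then in `I ⊞ J`, with cokernel an extension of `D'` by `A'`.
    obtain ⟨P, h₃, h₄⟩ := h.exists_pushout h₁
    obtain ⟨e⟩ := h₃.nonempty_iso_biprod (hGW _ hD _ hI).2
    obtain ⟨Q, h₅, h₆⟩ := h₄.exists_quotient
      ((h₂.biprod_left I).of_iso e.symm (Iso.refl _) (Iso.refl _))
    exact ⟨I ⊞ J, Q, hW _ _ hI hJ, ⟨A', D', hA', hD', h₅⟩, h₆⟩
  · rintro U ⟨A, D, hA, hD, h⟩
    obtain ⟨A', I, hA', hI, h₁⟩ := hG.exists_syzygy A hA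
    obtain ⟨D', J, hD', hJ, h₂⟩ := hG.exists_syzygy D hD
    obtain ⟨P, h₃, h₄⟩ := h.exists_pullback h₂
    obtain ⟨e⟩ := h₃.nonempty_iso_biprod (hGW _ hA _ hJ).1
    obtain ⟨Q, h₅, h₆⟩ := h₄.exists_kernel
      ((h₁.biprod_right J).of_iso (Iso.refl _) (Iso.refl _) (biprod.braiding _ _ ≪≫ e.symm))
    exact ⟨Q, J ⊞ I, ⟨A', D', hA', hD', h₅⟩, hW _ _ hJ hI, h₆⟩

/-- Passing to the Gorenstein subcategory of a subcategory `Y` lying between `W` and `X` stays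
inside `gorenstein W`. -/
lemma gorenstein_le_gorenstein {X Y : ObjectProperty C} (hWY : W ≤ Y) (hYX : Y ≤ X)
    (hXW : X ≤ extOrthogonal.{w} W)
    (hX : ∀ {A B D : C}, Conflation A B D → X A → X D → X B)
    (hcogen : ∀ A, X A → ∃ I A', W I ∧ X A' ∧ Conflation A I A')
    (hgen : ∀ A, X A → ∃ A' P, X A' ∧ W P ∧ Conflation A' P A) :
    gorenstein Y ≤ gorenstein W := by
  rintro M ⟨K, hK, ⟨e⟩⟩
  obtain ⟨Z, hZM, hZ, h⟩ := exists_isSyzygyClosed hK.acyclic (fun i => hYX _ (hK.mem i)) hXW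
    (fun A hA => hK.homFrom_acyclic A (hWY _ hA)) (fun A hA => hK.homInto_acyclic A (hWY _ hA))
    (zero_add 1) e
  exact h.le_gorenstein hZ hXW hX hcogen hgen M hZM

end Gorenstein

/-! ### The inclusions `X ⊆ G^n(X)` -/

/-- Every object of an additive subcategory is a cokernel in a contractible complex. -/
lemma le_gorenstein {Y : ObjectProperty C} (h0 : Y.ContainsZero)
    (hY : Y.IsClosedUnderIsomorphisms) : Y ≤ gorenstein Y := by
  intro M hM
  obtain ⟨O, hO, hYO⟩ := h0.exists_zero
  -- The complex is `M = M` in degrees `0` and `-1`; each `Z (i + 1) ⊞ Z i` has a zero summand, so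
  -- it is `M` or zero.
  let Z : ℤ → C := fun i => if i = 0 then M else O
  have hZ0 : Z 0 = M := if_pos rfl
  have hZ {i : ℤ} (hi : i ≠ 0) : Z i = O := if_neg hi
  have hZY (i : ℤ) : Y (Z i) := by
    by_cases hi : i = 0
    · rwa [hi, hZ0]
    · rwa [hZ hi]
  have hZY' (i : ℤ) : Y (Z (i + 1) ⊞ Z i) := by
    by_cases hi : i = 0
    · exact Y.prop_of_iso (isoZeroBiprod (by rwa [hZ (by omega)])) (hZY i)
    · exact Y.prop_of_iso (isoBiprodZero (by rwa [hZ hi])) (hZY (i + 1))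
  rw [← hZ0]
  exact gorenstein_of_shortExact (Z := Z) hZY' (f := fun _ => biprod.inl)
    (g := fun _ => biprod.snd) (fun _ => biprod.inl_snd)
    (fun i => (ShortComplex.Splitting.ofHasBinaryBiproduct _ _).shortExact)
    (fun A _ i x => ⟨x ≫ biprod.inr, by simp⟩) (fun A _ i x => ⟨biprod.fst ≫ x, by simp⟩)

lemma gorensteinIter_containsZero_and_isClosedUnderIsomorphisms {X : ObjectProperty C}
    (hX : IsAdditiveSubcategory X) (n : ℕ) :
    (gorensteinIter X n).ContainsZero ∧ (gorensteinIter X n).IsClosedUnderIsomorphisms := by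
  induction n with
  | zero => exact ⟨hX.containsZero, hX.closedUnderIso⟩
  | succ n ih =>
    obtain ⟨O, hO, hXO⟩ := ih.1.exists_zero
    refine ⟨⟨O, hO, le_gorenstein ih.1 ih.2 O hXO⟩, ⟨?_⟩⟩
    rintro A B e ⟨K, hK, ⟨e'⟩⟩
    exact ⟨K, hK, ⟨e.symm ≪≫ e'⟩⟩

lemma le_gorensteinIter {X : ObjectProperty C} (hX : IsAdditiveSubcategory X) (n : ℕ) :
    X ≤ gorensteinIter X n := by
  induction n with
  | zero => exact le_rfl
  | succ n ih =>
    have h := gorensteinIter_containsZero_and_isClosedUnderIsomorphisms hX n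
    exact ih.trans (le_gorenstein h.1 h.2)

end GorensteinSubcategory

/-! ### Induction on `n` -/

theorem mainTheorem4 {C : Type u} [Category.{v} C] [Abelian C] [HasExt.{w} C]
    (X W : ObjectProperty C)
    (hX : GorensteinSubcategory.IsAdditiveSubcategory X)
    (hW : GorensteinSubcategory.IsAdditiveSubcategory W)
    (hWX : W ≤ X)
    (hXext : X.IsClosedUnderExtensions)
    (hcogen : GorensteinSubcategory.IsInjectiveCogenerator.{w} W X)
    (hgen : GorensteinSubcategory.IsProjectiveGenerator.{w} W X)
    (n : ℕ) (hn : 1 ≤ n) :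
    GorensteinSubcategory.gorensteinIter X n ≤ GorensteinSubcategory.gorenstein W := by
  have hXW : X ≤ GorensteinSubcategory.extOrthogonal.{w} W := fun U hU A hA =>
    ⟨hgen.perp A U hA hU 1 le_rfl, hcogen.perp U A hU hA 1 le_rfl⟩
  have hWW := hWX.trans hXW
  have hG := GorensteinSubcategory.isSyzygyClosed_gorenstein hWW
  induction n, hn using Nat.le_induction with
  | base =>
    refine GorensteinSubcategory.gorenstein_le_gorenstein hWX le_rfl hXW ?_ ?_ ?_
    · rintro A B D ⟨f, g, w, hs⟩ hA hD
      exact hXext.prop_X₂_of_shortExact hs hA hD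
    · intro A hA
      obtain ⟨I, A', f, g, w, hI, -, hA', hs⟩ := hcogen.isCogenerator A hA
      exact ⟨I, A', hI, hA', f, g, w, hs⟩
    · intro A hA
      obtain ⟨A', P, f, g, w, hA', hP, -, hs⟩ := hgen.isGenerator A hA
      exact ⟨A', P, hA', hP, f, g, w, hs⟩
  | succ n _ ih =>
    -- The ambient class is now `G(W)` instead of `X`.
    exact GorensteinSubcategory.gorenstein_le_gorenstein
      (hWX.trans (GorensteinSubcategory.le_gorensteinIter hX n)) ih
      (GorensteinSubcategory.gorenstein_le_extOrthogonal hWW)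
      (fun h => GorensteinSubcategory.gorenstein_of_conflation hWW hW.biprod_mem h)
      hG.exists_cosyzygy hG.exists_syzygy
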